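/- Let $p,q\ge 0$ be integers with $n=p+q\ge 1$, and let $\mathcal{G}_{p,q}$ be the real Clifford geometric algebra with identity $e$ and generators $e_1,\dots,e_n$ satisfying $e_ae_b+e_be_a=2\eta_{ab}e$, where $\eta=\mathrm{diag}(1,\dots,1,-1,\dots,-1)$ has $p$ entries $1$ followed by $q$ entries $-1$. It has the basis of elements $e_A=e_{a_1}e_{a_2}\cdots e_{a_k}$, indexed by the subsets $A=\{a_1<\dots<a_k\}$ of $\{1,\dots,n\}$ (with $e_\varnothing=e$), each of which is invertible. For a multivector $U=\sum_A u_Ae_A$, $u_A\in\mathbb{R}$, put $U^\dagger:=\sum_A u_A(e_A)^{-1}$. Theorem (left and right polar decomposition). For every multivector $M\in\mathcal{G}_{p,q}$ there exist multivectors $P,S\in\mathcal{G}_{p,q}$ such that $$P^\dagger=P,\qquad S^\dagger=S,\qquad P=B^\dagger B,\qquad S=C^\dagger C\quad\text{for some multivectors } B,C\in\mathcal{G}_{p,q},$$ and a multivector $W\in \mathrm{G}\mathcal{G}_{p,q}:=\{U\in\mathcal{G}_{p,q}: U^\dagger U=e\}$ such that $$M=WP=SW.$$ -/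

import Mathlib

noncomputable section

namespace GA

/-- The diagonal entries of `η = diag(1, …, 1, -1, …, -1)`, with `p` entries `1` followed by
`q` entries `-1`. -/
def eta (p q : ℕ) (a : Fin (p + q)) : ℝ := if (a : ℕ) < p then 1 else -1

/-- The quadratic form `x ↦ ∑ₐ η_aa x_a²` of signature `(p, q)` on `ℝ^(p+q)`. -/
def form (p q : ℕ) : QuadraticForm ℝ (Fin (p + q) → ℝ) :=
  QuadraticMap.weightedSumSquares ℝ (eta p q)

/-- The real Clifford geometric algebra `𝒢_{p,q}`. -/
abbrev Alg (p q : ℕ) : Type := CliffordAlgebra (form p q)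

variable {p q : ℕ}

/-- The generators `e_a`. -/
def gen (a : Fin (p + q)) : Alg p q := CliffordAlgebra.ι (form p q) (Pi.single a 1)

/-- The element `e_A = e_{a₁} e_{a₂} ⋯ e_{a_k}` for `A = {a₁ < a₂ < ⋯ < a_k}`
(and `e_∅ = e = 1`). -/
def blade (A : Finset (Fin (p + q))) : Alg p q := ((A.sort (· ≤ ·)).map gen).prod

theorem form_single (a : Fin (p + q)) : form p q (Pi.single a 1) = eta p q a := by
  simp [form, Pi.single_apply]

theorem eta_ne_zero (a : Fin (p + q)) : eta p q a ≠ 0 := by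
  unfold eta; split_ifs <;> norm_num

/-- The defining relations `e_a e_b + e_b e_a = 2 η_ab e`. -/
theorem gen_mul_gen_add (a b : Fin (p + q)) :
    (gen a * gen b + gen b * gen a : Alg p q) =
      algebraMap ℝ (Alg p q) (2 * Matrix.diagonal (eta p q) a b) := by
  unfold gen
  rw [CliffordAlgebra.ι_mul_ι_add_swap]
  congr 1
  by_cases h : a = b
  · subst h
    rw [QuadraticMap.polar_self, form_single, Matrix.diagonal_apply_eq]
    simp
  · rw [Matrix.diagonal_apply_ne _ h, QuadraticMap.polar]
    simp only [form, QuadraticMap.weightedSumSquares_apply, smul_eq_mul, mul_zero,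
      ← Finset.sum_sub_distrib]
    refine Finset.sum_eq_zero fun i _ => ?_
    by_cases h1 : i = a
    · subst h1
      simp [h]
    · simp [h1]

/-- Every `e_A` is invertible. -/
theorem isUnit_blade (A : Finset (Fin (p + q))) : IsUnit (blade A : Alg p q) := by
  unfold blade
  generalize A.sort (· ≤ ·) = l
  induction l with
  | nil => simp
  | cons a l ih =>
    rw [List.map_cons, List.prod_cons]
    refine IsUnit.mul ?_ ih
    refine CliffordAlgebra.isUnit_ι_of_isUnit _ ?_
    rw [form_single]
    exact (eta_ne_zero a).isUnit

theorem contractLeft_prod {Q : QuadraticForm ℝ (Fin (p + q) → ℝ)}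
    (d : Module.Dual ℝ (Fin (p + q) → ℝ)) (l : List (Fin (p + q)))
    (hd : ∀ b ∈ l, d (Pi.single b 1) = 0) :
    CliffordAlgebra.contractLeft d
      (l.map fun a => CliffordAlgebra.ι Q (Pi.single a 1)).prod = 0 := by
  induction l with
  | nil => simp
  | cons a l ih =>
    rw [List.map_cons, List.prod_cons, CliffordAlgebra.contractLeft_ι_mul,
      hd a (by simp), ih fun b hb => hd b (by simp [hb])]
    simp

theorem associated_single {a b : Fin (p + q)} (h : a ≠ b) :
    QuadraticMap.associated (R := ℝ) (-form p q) (Pi.single a 1) (Pi.single b 1) = 0 := by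
  have h2 : QuadraticMap.polar (form p q) (Pi.single a 1) (Pi.single b 1) = 0 := by
    have := gen_mul_gen_add (p := p) (q := q) a b
    unfold gen at this
    rw [CliffordAlgebra.ι_mul_ι_add_swap, Matrix.diagonal_apply_ne _ h, mul_zero] at this
    exact (algebraMap ℝ (Alg p q)).injective this
  rw [map_neg]
  simp only [QuadraticMap.associated_apply, LinearMap.neg_apply]
  rw [QuadraticMap.polar] at h2
  simp [h2]

theorem equivExterior_prod (l : List (Fin (p + q))) (hl : l.Nodup) :
    CliffordAlgebra.equivExterior (form p q) (l.map gen).prod =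
      (l.map fun a => ExteriorAlgebra.ι ℝ (Pi.single a 1 : Fin (p + q) → ℝ)).prod := by
  rw [CliffordAlgebra.equivExterior, CliffordAlgebra.changeFormEquiv_apply]
  induction l with
  | nil => simp
  | cons a l ih =>
    rw [List.nodup_cons] at hl
    rw [List.map_cons, List.prod_cons, gen, CliffordAlgebra.changeForm_ι_mul, ih hl.2,
      List.map_cons, List.prod_cons]
    have := contractLeft_prod (Q := 0)
      (QuadraticMap.associated (R := ℝ) (-form p q) (Pi.single a 1)) l
      fun b hb => associated_single (by rintro rfl; exact hl.1 hb)
    erw [this]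
    rw [sub_zero]

/-- The basis `(e_A)` of `𝒢_{p,q}`, indexed by all subsets `A` of `{1, …, n}`; see
`bladeBasis_apply`. -/
def bladeBasis (p q : ℕ) : Module.Basis (Finset (Fin (p + q))) ℝ (Alg p q) :=
  (Pi.basisFun ℝ (Fin (p + q))).ExteriorAlgebra.map
    (CliffordAlgebra.equivExterior (form p q)).symm

theorem bladeBasis_apply (A : Finset (Fin (p + q))) : bladeBasis p q A = blade A := by
  rw [bladeBasis, Module.Basis.map_apply, LinearEquiv.symm_apply_eq, blade,
    equivExterior_prod _ (A.sort_nodup _), ExteriorAlgebra.basis_apply_ofCard _ rfl,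
    ← Finset.listMap_orderEmbOfFin_finRange A rfl, ExteriorAlgebra.ιMulti_family,
    ExteriorAlgebra.ιMulti_apply, List.ofFn_eq_map, List.map_map]
  congr 1
  refine List.map_congr_left fun i _ => ?_
  simp [Set.powersetCard.ofFinEmbEquiv_symm_apply]

/-- The coordinate `m_A` of the multivector `M = ∑_A m_A e_A`. -/
def coord (M : Alg p q) (A : Finset (Fin (p + q))) : ℝ := (bladeBasis p q).repr M A

/-- Every multivector is `M = ∑_A m_A e_A`. -/
theorem sum_coord (M : Alg p q) : ∑ A, coord M A • blade A = M := by
  simpa only [bladeBasis_apply, coord] using (bladeBasis p q).sum_repr M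

/-- Hermitian conjugation `M† = ∑_A m_A (e_A)⁻¹`. The inverses are genuine, as every `e_A` is a
unit (`isUnit_blade`). -/
def dagger (M : Alg p q) : Alg p q := ∑ A, coord M A • Ring.inverse (blade A)

/-- The set `G𝒢_{p,q} = {U : U† U = e}`. -/
def GG (p q : ℕ) : Set (Alg p q) := {U | dagger U * U = 1}

end GA

end

namespace GA

/-! Dagger inverts every blade, so it is the linear anti-involution `conj`; averaging an inner
product over the generators makes dagger the adjoint for left multiplication (`exists_adjointForm`).
The algebra is thus a finite-dimensional `*`-algebra of operators on itself, and the matrix argument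
applies. A polynomial in `M†M` gives a self-adjoint `B` with `B ^ 4 = M†M`, so `P = B ^ 2 = B†B` is
a square root of `M†M`. For invertible `M`, take `W = M P⁻¹`; other `M` are limits of invertible
ones, and compactness passes the decomposition to the limit. The right form comes from conjugating
`P` by `W`. -/

/-- The data making a real algebra a `*`-algebra of operators on itself: a linear anti-involution
`d` and a positive definite form for which `d x` acts as the adjoint of `x`. -/
structure AdjointForm {A : Type*} [Ring A] [Algebra ℝ A] (d : A →ₗ[ℝ] A)
    (β : A →ₗ[ℝ] A →ₗ[ℝ] ℝ) : Prop where
  map_mul : ∀ x y, d (x * y) = d y * d x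
  invol : ∀ x, d (d x) = x
  symm : ∀ x y, β x y = β y x
  pos : ∀ x, x ≠ 0 → 0 < β x x
  adjoint : ∀ x y z, β (x * y) z = β y (d x * z)

/-! ### Polar decomposition in an algebra with an adjoint form -/

namespace AdjointForm

variable {A : Type*} [Ring A] [Algebra ℝ A] {d : A →ₗ[ℝ] A} {β : A →ₗ[ℝ] A →ₗ[ℝ] ℝ}

theorem map_one (h : AdjointForm d β) : d 1 = 1 := by
  have := h.map_mul 1 (d 1)
  rw [one_mul, h.invol, one_mul] at this
  exact this.symm

theorem nonneg (h : AdjointForm d β) (x : A) : 0 ≤ β x x := by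
  rcases eq_or_ne x 0 with rfl | hx
  · simp
  · exact (h.pos x hx).le

theorem isometry_of_mul_eq_one (h : AdjointForm d β) {w : A} (hw : d w * w = 1) (x : A) :
    β (w * x) (w * x) = β x x := by
  rw [h.adjoint, ← mul_assoc, hw, one_mul]

theorem map_aeval (h : AdjointForm d β) {x : A} (hx : d x = x) (f : Polynomial ℝ) :
    d (Polynomial.aeval x f) = Polynomial.aeval x f := by
  have hpow : ∀ n : ℕ, d (x ^ n) = x ^ n := by
    intro n
    induction n with
    | zero => simpa using h.map_one
    | succ n ih => rw [pow_succ, h.map_mul, ih, hx, ← pow_succ', pow_succ]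
  simp [Polynomial.aeval_eq_sum_range, hpow]

/-- The inner product space structure defined by the form. -/
abbrev core (h : AdjointForm d β) : InnerProductSpace.Core ℝ A where
  inner x y := β x y
  conj_inner_symm x y := by simpa using h.symm y x
  re_inner_nonneg x := by simpa using h.nonneg x
  add_left x y z := by simp
  smul_left x y r := by simp
  definite x hx := by
    by_contra hne
    exact (h.pos x hne).ne' hx

/-- An element `d M * M` has a self-adjoint fourth root. -/
theorem exists_fourth_root [FiniteDimensional ℝ A] (h : AdjointForm d β) (M : A) :
    ∃ B : A, d B = B ∧ B ^ 4 = d M * M := by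
  let := h.core.toNormedAddCommGroup
  let : InnerProductSpace ℝ A := InnerProductSpace.ofCore h.core.toCore
  set H := d M * M with hH
  have hHd : d H = H := by rw [hH, h.map_mul, h.invol]
  have hin : ∀ x y : A, inner ℝ x y = β x y := fun _ _ => rfl
  have hsymm : (LinearMap.mulLeft ℝ H).IsSymmetric := by
    intro x y
    simp only [hin, LinearMap.mulLeft_apply]
    rw [h.adjoint, hHd]
  set b := hsymm.eigenvectorBasis rfl with hb
  set ev := hsymm.eigenvalues rfl with hev
  have hbe : ∀ i, H * b i = ev i • b i := fun i =>
    hsymm.apply_eigenvectorBasis rfl i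
  have hpos : ∀ i, 0 ≤ ev i := by
    intro i
    have h1 : β (b i) (H * b i) = ev i * β (b i) (b i) := by rw [hbe]; simp
    have h2 : 0 < β (b i) (b i) := h.pos _ (b.orthonormal.ne_zero i)
    have h3 : 0 ≤ β (b i) (H * b i) := by
      rw [hH, mul_assoc, ← h.adjoint]
      exact h.nonneg _
    rw [h1] at h3
    exact nonneg_of_mul_nonneg_left h3 h2
  -- Interpolating on the eigenvalues makes the root a polynomial in `H`, so it lies in the algebra
  -- and is self-adjoint.
  let f : Polynomial ℝ := Lagrange.interpolate (Finset.univ.image ev) id fun t => √(√t)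
  have hf : ∀ i, f.eval (ev i) = √(√(ev i)) := fun i =>
    Lagrange.eval_interpolate_at_node (v := id) (fun t => √(√t)) (Function.injective_id.injOn)
      (Finset.mem_image_of_mem ev (Finset.mem_univ i))
  have hact : ∀ i (g : Polynomial ℝ), Polynomial.aeval H g * b i = g.eval (ev i) • b i := by
    intro i g
    induction g using Polynomial.induction_on' with
    | add g k hg hk => simp [add_mul, add_smul, hg, hk]
    | monomial n a =>
      have : ∀ n : ℕ, H ^ n * b i = ev i ^ n • b i := by
        intro n
        induction n with
        | zero => simp
        | succ n ih => rw [pow_succ, mul_assoc, hbe, mul_smul_comm, ih, smul_smul, pow_succ']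
      simp [Polynomial.aeval_monomial, ← Algebra.smul_def, this, smul_smul]
  refine ⟨Polynomial.aeval H f, h.map_aeval hHd f, ?_⟩
  have key : LinearMap.mulLeft ℝ (Polynomial.aeval H f ^ 4) = LinearMap.mulLeft ℝ H := by
    refine b.toBasis.ext fun i => ?_
    simp only [OrthonormalBasis.coe_toBasis, LinearMap.mulLeft_apply]
    rw [← map_pow, hact, hbe, Polynomial.eval_pow, hf]
    congr 1
    rw [show 4 = 2 * 2 from rfl, pow_mul, Real.sq_sqrt (Real.sqrt_nonneg _),
      Real.sq_sqrt (hpos i)]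
  simpa using LinearMap.congr_fun key 1

/-- With `B ^ 4 = d M * M`, the element `W = M B⁻²` satisfies `d W * W = B⁻² B⁴ B⁻² = 1`. -/
theorem exists_polar_of_isUnit [FiniteDimensional ℝ A] (h : AdjointForm d β) {M : A}
    (hM : IsUnit M) : ∃ W B : A, d W * W = 1 ∧ M = W * (d B * B) := by
  obtain ⟨B, hB, hB4⟩ := h.exists_fourth_root M
  obtain ⟨u, rfl⟩ := hM
  have hdu : d ↑u * d ↑u⁻¹ = 1 := by rw [← h.map_mul, u.inv_mul, h.map_one]
  have hdu' : d ↑u⁻¹ * d ↑u = 1 := by rw [← h.map_mul, u.mul_inv, h.map_one]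
  have hBu : IsUnit B := by
    rw [← isUnit_pow_iff (n := 4) (by norm_num), hB4]
    exact (Units.mk _ _ hdu hdu').isUnit.mul u.isUnit
  obtain ⟨v, rfl⟩ := hBu
  have hv : d ↑v⁻¹ = (↑v⁻¹ : A) := by
    have : (v : A) * d ↑v⁻¹ = 1 := by
      nth_rewrite 1 [← hB]
      rw [← h.map_mul, v.inv_mul, h.map_one]
    exact (Units.inv_eq_of_mul_eq_one_right this).symm
  refine ⟨u * (↑v⁻¹ * ↑v⁻¹), v, ?_, ?_⟩
  · rw [h.map_mul, h.map_mul, hv]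
    calc (↑v⁻¹ * ↑v⁻¹ * d ↑u * (↑u * (↑v⁻¹ * ↑v⁻¹)) : A)
        = ↑v⁻¹ * ↑v⁻¹ * (d ↑u * ↑u) * (↑v⁻¹ * ↑v⁻¹) := by simp only [mul_assoc]
      _ = ((v⁻¹ * v⁻¹ * v ^ 4 * (v⁻¹ * v⁻¹) : Aˣ) : A) := by rw [← hB4]; push_cast; rfl
      _ = 1 := by
        have : v⁻¹ * v⁻¹ * v ^ 4 * (v⁻¹ * v⁻¹) = 1 := by group
        rw [this, Units.val_one]
  · rw [hB]
    simp [mul_assoc]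

theorem exists_polar [FiniteDimensional ℝ A] (h : AdjointForm d β) (M : A) :
    ∃ W B : A, d W * W = 1 ∧ M = W * (d B * B) := by
  let := h.core.toNormedAddCommGroup
  let : InnerProductSpace ℝ A := InnerProductSpace.ofCore h.core.toCore
  have : ProperSpace A := FiniteDimensional.proper_real A
  have hnorm : ∀ x : A, ‖x‖ ^ 2 = β x x := fun x => (real_inner_self_eq_norm_sq x).symm
  have hd : Continuous d := d.continuous_of_finiteDimensional
  have hm : Continuous fun x : A × A => x.1 * x.2 := by
    have h1 : Continuous (fun x : A =>
        LinearMap.toContinuousLinearMap (LinearMap.mul ℝ A x)) :=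
      (LinearMap.toContinuousLinearMap.toLinearMap ∘ₗ
        LinearMap.mul ℝ A).continuous_of_finiteDimensional
    exact (h1.comp continuous_fst).clm_apply continuous_snd
  have : ContinuousMul A := ⟨hm⟩
  let Z : Set A := {M | ∃ W B : A, d W * W = 1 ∧ M = W * (d B * B)}
  have hbdW : ∀ W : A, d W * W = 1 → ‖W‖ = ‖(1 : A)‖ := by
    intro W hW
    rw [← sq_eq_sq₀ (norm_nonneg _) (norm_nonneg _), hnorm, hnorm,
      ← h.isometry_of_mul_eq_one hW 1, mul_one]
  have hbdB : ∀ W B : A, d W * W = 1 → ‖B‖ ^ 2 ≤ ‖(1 : A)‖ * ‖W * (d B * B)‖ := by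
    intro W B hW
    have h1 : ‖W * (d B * B)‖ = ‖d B * B‖ := by
      rw [← sq_eq_sq₀ (norm_nonneg _) (norm_nonneg _), hnorm, hnorm, h.isometry_of_mul_eq_one hW]
    rw [h1, hnorm]
    -- Cauchy–Schwarz against `1` bounds `B` by the product, so the factors of a convergent sequence
    -- stay in a compact set.
    have h2 : β B B = inner ℝ (1 : A) (d B * B) := by
      have := h.adjoint B 1 B
      rwa [mul_one] at this
    rw [h2]
    exact real_inner_le_norm _ _
  have hZ : IsClosed Z := by
    refine IsSeqClosed.isClosed fun x a hx hxa => ?_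
    choose W B hW hxWB using hx
    obtain ⟨r, hr⟩ := hxa.norm.bddAbove_range
    have hbd : ∀ n, (W n, B n) ∈ Metric.closedBall (0 : A) ‖(1 : A)‖ ×ˢ
        Metric.closedBall (0 : A) √(‖(1 : A)‖ * r) := by
      intro n
      simp only [Set.mem_prod, mem_closedBall_zero_iff]
      refine ⟨(hbdW _ (hW n)).le, Real.le_sqrt_of_sq_le ((hbdB _ _ (hW n)).trans ?_)⟩
      rw [← hxWB]
      exact mul_le_mul_of_nonneg_left (hr ⟨n, rfl⟩) (norm_nonneg _)
    obtain ⟨⟨W', B'⟩, -, φ, hφ, hlim⟩ :=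
      ((isCompact_closedBall (0 : A) _).prod (isCompact_closedBall (0 : A) _)).tendsto_subseq hbd
    have hWl := (continuous_fst.tendsto _).comp hlim
    have hBl := (continuous_snd.tendsto _).comp hlim
    refine ⟨W', B', ?_, ?_⟩
    · refine tendsto_nhds_unique (((hd.tendsto _).comp hWl).mul hWl) ?_
      refine tendsto_const_nhds.congr fun n => ?_
      exact (hW _).symm
    · refine tendsto_nhds_unique (hxa.comp hφ.tendsto_atTop) ?_
      refine (hWl.mul (((hd.tendsto _).comp hBl).mul hBl)).congr fun n => ?_
      exact (hxWB _).symm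
  -- The spectrum of left multiplication by `M` is finite, so `M - t` is invertible for all small `t
  -- ≠ 0`.
  have hfreq : ∀ᶠ t : ℝ in nhdsWithin 0 {0}ᶜ, M - algebraMap ℝ A t ∈ Z := by
    have hfin : (spectrum ℝ (Algebra.lmul ℝ A M) \ {0}).Finite :=
      (Module.End.finite_spectrum _).sdiff
    have h0 : (spectrum ℝ (Algebra.lmul ℝ A M) \ {0})ᶜ ∈ nhds (0 : ℝ) :=
      hfin.isClosed.isOpen_compl.mem_nhds (by simp)
    filter_upwards [nhdsWithin_le_nhds h0, self_mem_nhdsWithin] with t ht ht0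
    refine h.exists_polar_of_isUnit ?_
    have hnot : t ∉ spectrum ℝ (Algebra.lmul ℝ A M) := fun hs => ht ⟨hs, ht0⟩
    rw [spectrum.notMem_iff, IsUnit.sub_iff, ← AlgHom.commutes (Algebra.lmul ℝ A) t,
      ← map_sub] at hnot
    exact Algebra.lmul_isUnit_iff.mp hnot
  have hlim : Filter.Tendsto (fun t : ℝ => M - algebraMap ℝ A t) (nhdsWithin 0 {0}ᶜ)
      (nhds M) := by
    have : Continuous fun t : ℝ => M - algebraMap ℝ A t :=
      continuous_const.sub (Algebra.linearMap ℝ A).continuous_of_finiteDimensional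
    have h0 := this.tendsto 0
    rw [_root_.map_zero, sub_zero] at h0
    exact h0.mono_left nhdsWithin_le_nhds
  exact hZ.mem_of_tendsto hlim hfreq

end AdjointForm

end GA

/-! ### Dagger as an adjoint on the Clifford algebra -/

noncomputable section
namespace GA
variable {p q : ℕ}

theorem eta_mul_self (a : Fin (p + q)) : eta p q a * eta p q a = 1 := by
  unfold eta; split_ifs <;> norm_num

theorem gen_mul_self (a : Fin (p + q)) :
    (gen a * gen a : Alg p q) = algebraMap ℝ (Alg p q) (eta p q a) := by
  rw [gen, CliffordAlgebra.ι_sq_scalar, form_single]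

theorem gen_mul_gen_of_ne {a b : Fin (p + q)} (h : a ≠ b) :
    (gen a * gen b : Alg p q) = -(gen b * gen a) := by
  rw [eq_neg_iff_add_eq_zero, gen_mul_gen_add, Matrix.diagonal_apply_ne _ h]
  simp

/-- The isometry of `ℝ^(p+q)` multiplying the `a`-th coordinate by `η_aa`. -/
def etaIsometry (p q : ℕ) : form p q →qᵢ form p q where
  toLinearMap := LinearMap.pi fun a => eta p q a • LinearMap.proj a
  map_app' x := by
    simp only [form, QuadraticMap.weightedSumSquares_apply]
    refine Finset.sum_congr rfl fun a _ => ?_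
    have := eta_mul_self a
    simp only [AddHom.toFun_eq_coe, LinearMap.coe_toAddHom, LinearMap.pi_apply,
      LinearMap.smul_apply, LinearMap.proj_apply, smul_eq_mul]
    linear_combination eta p q a * x a * x a * this

/-- The linear anti-automorphism of `𝒢_{p,q}` sending each `e_a` to its inverse `η_aa e_a`. -/
def conj (p q : ℕ) : Alg p q →ₗ[ℝ] Alg p q :=
  CliffordAlgebra.reverse ∘ₗ (CliffordAlgebra.map (etaIsometry p q)).toLinearMap

theorem conj_mul (x y : Alg p q) : conj p q (x * y) = conj p q y * conj p q x := by
  simp [conj, CliffordAlgebra.reverse.map_mul]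

theorem conj_one : conj p q 1 = 1 := by
  simp [conj]

theorem conj_gen (a : Fin (p + q)) : conj p q (gen a) = eta p q a • gen a := by
  have : etaIsometry p q (Pi.single a 1) = eta p q a • Pi.single a 1 := by
    ext b
    change eta p q b * (Pi.single a 1 : Fin (p + q) → ℝ) b = _
    by_cases h : b = a
    · subst h; simp
    · simp [h]
  simp [conj, gen, this]

theorem conj_gen_mul_gen (a : Fin (p + q)) : conj p q (gen a) * gen a = 1 := by
  rw [conj_gen, smul_mul_assoc, gen_mul_self, Algebra.smul_def, ← map_mul, eta_mul_self,
    map_one]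

theorem gen_mul_conj_gen (a : Fin (p + q)) : gen a * conj p q (gen a) = 1 := by
  rw [← conj_gen_mul_gen a, conj_gen, mul_smul_comm, smul_mul_assoc]

theorem conj_conj_gen (a : Fin (p + q)) : conj p q (conj p q (gen a)) = gen a := by
  rw [conj_gen, map_smul, conj_gen, smul_smul, eta_mul_self, one_smul]

theorem conj_prod_mul (l : List (Fin (p + q))) :
    conj p q (l.map gen).prod * (l.map gen).prod = 1 := by
  induction l with
  | nil => simp [conj_one]
  | cons a l ih =>
    rw [List.map_cons, List.prod_cons, conj_mul, mul_assoc, ← mul_assoc (conj p q (gen a)),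
      conj_gen_mul_gen, one_mul, ih]

/-- On each blade `conj` gives a left inverse, which is the inverse because blades are units;
linearity does the rest. -/
theorem dagger_eq_conj (x : Alg p q) : dagger x = conj p q x := by
  conv_rhs => rw [← sum_coord x]
  rw [dagger, map_sum]
  refine Finset.sum_congr rfl fun A _ => ?_
  rw [map_smul]
  congr 1
  have h := conj_prod_mul (A.sort (· ≤ ·))
  rw [← blade] at h
  rw [← one_mul (Ring.inverse _), ← h, mul_assoc, Ring.mul_inverse_cancel _ (isUnit_blade A),
    mul_one]

theorem conj_conj (x : Alg p q) : conj p q (conj p q x) = x := by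
  have hprod : ∀ l : List (Fin (p + q)),
      conj p q (conj p q (l.map gen).prod) = (l.map gen).prod := by
    intro l
    induction l with
    | nil => simp [conj_one]
    | cons a l ih => rw [List.map_cons, List.prod_cons, conj_mul, conj_mul, conj_conj_gen, ih]
  have : conj p q ∘ₗ conj p q = LinearMap.id := by
    refine (bladeBasis p q).ext fun A => ?_
    rw [bladeBasis_apply]
    exact hprod _
  exact LinearMap.congr_fun this x

/-- Averaging an inner product over the generators makes it invariant under each of them. -/
theorem exists_form_invariant (s : Finset (Fin (p + q))) :
    ∃ β : Alg p q →ₗ[ℝ] Alg p q →ₗ[ℝ] ℝ, (∀ x y, β x y = β y x) ∧ (∀ x, x ≠ 0 → 0 < β x x) ∧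
      ∀ a ∈ s, ∀ x y, β (gen a * x) (gen a * y) = β x y := by
  induction s using Finset.induction_on with
  | empty =>
    refine ⟨∑ A, (LinearMap.mul ℝ ℝ).compl₁₂ ((bladeBasis p q).coord A) ((bladeBasis p q).coord A),
      fun x y => ?_, fun x hx => ?_, by simp⟩
    · simp [LinearMap.sum_apply, mul_comm]
    · simp only [LinearMap.sum_apply, LinearMap.compl₁₂_apply, LinearMap.mul_apply']
      refine lt_of_le_of_ne (Finset.sum_nonneg fun A _ => mul_self_nonneg _) fun h0 => hx ?_
      rw [eq_comm, Finset.sum_eq_zero_iff_of_nonneg fun A _ => mul_self_nonneg _] at h0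
      refine (bladeBasis p q).ext_elem fun A => ?_
      simpa using h0 A (Finset.mem_univ A)
  | insert b s _ ih =>
    obtain ⟨β, hsymm, hpos, hinv⟩ := ih
    -- Left multiplication by `gen b` swaps the two summands since `gen b` squares to `±1`. Earlier
    -- invariances survive because `gen a` and `gen b` anticommute and the two signs cancel.
    refine ⟨β + β.compl₁₂ (LinearMap.mulLeft ℝ (gen b)) (LinearMap.mulLeft ℝ (gen b)),
      fun x y => ?_, fun x hx => ?_, fun a ha x y => ?_⟩
    · simp [hsymm x y, hsymm (gen b * x)]
    · have hb : gen b * x ≠ 0 := fun h0 => hx <| by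
        rw [← one_mul x, ← conj_gen_mul_gen b, mul_assoc, h0, mul_zero]
      simpa using add_pos (hpos x hx) (hpos _ hb)
    · simp only [LinearMap.add_apply, LinearMap.compl₁₂_apply, LinearMap.mulLeft_apply]
      by_cases hab : a = b
      · subst hab
        have hsq : ∀ z : Alg p q, gen a * (gen a * z) = eta p q a • z := fun z => by
          rw [← mul_assoc, gen_mul_self, Algebra.smul_def]
        rw [hsq, hsq, map_smul, map_smul, LinearMap.smul_apply, smul_smul, eta_mul_self, one_smul,
          add_comm]
      · have has : a ∈ s := (Finset.mem_insert.mp ha).resolve_left hab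
        have hsw : ∀ z : Alg p q, gen b * (gen a * z) = -(gen a * (gen b * z)) := fun z => by
          rw [← mul_assoc, gen_mul_gen_of_ne (Ne.symm hab), neg_mul, mul_assoc]
        rw [hsw, hsw, map_neg, map_neg, LinearMap.neg_apply, neg_neg, hinv a has, hinv a has]

/-- Each generator acts as an isometry, so its adjoint is its inverse, which is its `conj`; this
extends to products and then linearly. -/
theorem exists_adjointForm (p q : ℕ) : ∃ β, AdjointForm (conj p q) β := by
  obtain ⟨β, hsymm, hpos, hinv⟩ := exists_form_invariant (p := p) (q := q) Finset.univ
  refine ⟨β, conj_mul, conj_conj, hsymm, hpos, fun x y z => ?_⟩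
  have hgen : ∀ a (y z : Alg p q), β (gen a * y) z = β y (conj p q (gen a) * z) := by
    intro a y z
    rw [← hinv a (Finset.mem_univ a) y, ← mul_assoc, gen_mul_conj_gen, one_mul]
  have hprod : ∀ (l : List (Fin (p + q))) (y z : Alg p q),
      β ((l.map gen).prod * y) z = β y (conj p q (l.map gen).prod * z) := by
    intro l
    induction l with
    | nil => simp [conj_one]
    | cons a l ih =>
      intro y z
      rw [List.map_cons, List.prod_cons, mul_assoc, hgen, ih, conj_mul, mul_assoc]
  rw [← sum_coord x]
  simp only [Finset.sum_mul, map_sum, LinearMap.sum_apply, smul_mul_assoc, map_smul,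
    LinearMap.smul_apply]
  exact Finset.sum_congr rfl fun A _ => congrArg _ (hprod _ y z)

end GA
end

/-- Left and right polar decomposition in `𝒢_{p,q}`. -/
theorem theorem2 (p q : ℕ) (M : GA.Alg p q) :
    ∃ P S : GA.Alg p q,
      GA.dagger P = P ∧ GA.dagger S = S ∧
      (∃ B : GA.Alg p q, P = GA.dagger B * B) ∧
      (∃ C : GA.Alg p q, S = GA.dagger C * C) ∧
      ∃ W ∈ GA.GG p q, M = W * P ∧ M = S * W := by
  obtain ⟨β, h⟩ := GA.exists_adjointForm p q
  have : FiniteDimensional ℝ (GA.Alg p q) := (GA.bladeBasis p q).finiteDimensional_of_finite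
  obtain ⟨W, B, hW, hM⟩ := h.exists_polar M
  have hsa : ∀ x : GA.Alg p q, GA.dagger (GA.dagger x * x) = GA.dagger x * x := fun x => by
    simp only [GA.dagger_eq_conj, GA.conj_mul, GA.conj_conj]
  -- `C = B W†` gives `S = W P W†`, hence `S W = W P` by `W†W = 1`.
  refine ⟨GA.dagger B * B, GA.dagger (B * GA.dagger W) * (B * GA.dagger W), hsa _, hsa _, ⟨_, rfl⟩,
    ⟨_, rfl⟩, W, ?_, ?_, ?_⟩
  · change GA.dagger W * W = 1
    rwa [GA.dagger_eq_conj]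
  · rwa [GA.dagger_eq_conj]
  · simp only [GA.dagger_eq_conj, GA.conj_mul, GA.conj_conj]
    simp only [mul_assoc, hW, mul_one]
    exact hM
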